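/- Let \(N \ge 2\) be an integer and let \(1 < p < \infty\). Write \(\mathbb{R}^N_+ = \{y \in \mathbb{R}^N : y_N > 0\}\) and identify its boundary \(\partial\mathbb{R}^N_+ = \mathbb{R}^{N-1}\times\{0\}\) with \(\mathbb{R}^{N-1}\), equipped with Lebesgue measure. There exists a constant \(C \in [0,\infty)\), depending only on \(N\) and \(p\), such that the following holds. If \(u \colon \mathbb{R}^N_+ \to \mathbb{R}\) and \(v \colon \partial\mathbb{R}^N_+ \to \mathbb{R}\) are (Lebesgue) measurable functions satisfying \[ L(u,v) := \liminf_{s \to 1^-}\, (1-s) \int_{\partial\mathbb{R}^N_+} \biggl(\int_{\mathbb{R}^N_+} \frac{|v(x)-u(y)|^p}{|x-y|^{N+sp}} \,\mathrm{d}y\biggr)\,\mathrm{d}x < \infty , \] then \(v \in \dot W^{1,p}(\partial\mathbb{R}^N_+)\), that is, \(v\) is locally integrable and has a weak gradient \(\mathrm{D}v \in L^p(\partial\mathbb{R}^N_+)\), and \[ \int_{\partial\mathbb{R}^N_+} |\mathrm{D}v|^p \le C\, L(u,v). \] -/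

import Mathlib

open Filter Topology MeasureTheory
open scoped ENNReal NNReal ContDiff

noncomputable section

/-- The open half-space of points of Euclidean space `ℝ^(n+1)` whose last coordinate is
positive. -/
def openHalfSpace (n : ℕ) : Set (EuclideanSpace ℝ (Fin (n + 1))) :=
  {y | 0 < y (Fin.last n)}

/-- The isometric parametrization `x ↦ (x, 0)` of the boundary hyperplane `{y | y_(n+1) = 0}` of
the half-space by `ℝ^n`. Functions and integrals on the boundary are written in this parameter,
with Lebesgue measure on `ℝ^n`. -/
def boundaryPoint {n : ℕ} (x : EuclideanSpace ℝ (Fin n)) : EuclideanSpace ℝ (Fin (n + 1)) :=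
  WithLp.toLp 2 (Fin.snoc (α := fun _ => ℝ) (fun i => x i) 0)

/-- The trace conjunction integral, with `N = n + 1`,
`∫_{∂ℝ^N_+} (∫_{ℝ^N_+} |v(x) - u(y)|^p / |x - y|^(N + s p) dy) dx`, as a value in `[0, ∞]`.
Only the values of `u` on the half-space matter. -/
def traceConjunctionIntegral (n : ℕ) (s p : ℝ) (u : EuclideanSpace ℝ (Fin (n + 1)) → ℝ)
    (v : EuclideanSpace ℝ (Fin n) → ℝ) : ℝ≥0∞ :=
  ∫⁻ x : EuclideanSpace ℝ (Fin n), ∫⁻ y in openHalfSpace n,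
    ENNReal.ofReal (|v x - u y| ^ p / dist (boundaryPoint x) y ^ (((n + 1 : ℕ) : ℝ) + s * p))

/-- The lower limit, as `s → 1` with `s < 1`, of `1 - s` times the trace conjunction integral. -/
def liminfTraceConjunction (n : ℕ) (p : ℝ) (u : EuclideanSpace ℝ (Fin (n + 1)) → ℝ)
    (v : EuclideanSpace ℝ (Fin n) → ℝ) : ℝ≥0∞ :=
  liminf (fun s : ℝ => ENNReal.ofReal (1 - s) * traceConjunctionIntegral n s p u v) (𝓝[<] 1)

/-- `G` is a weak gradient of `v` on `ℝ^n`: both are locally integrable and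
`∫ v ∂ᵢφ = -∫ Gᵢ φ` for every smooth compactly supported `φ` and every `i`. -/
structure HasWeakGradient {n : ℕ} (v : EuclideanSpace ℝ (Fin n) → ℝ)
    (G : EuclideanSpace ℝ (Fin n) → EuclideanSpace ℝ (Fin n)) : Prop where
  locallyIntegrable : LocallyIntegrable v volume
  locallyIntegrable_gradient : LocallyIntegrable G volume
  integral_eq : ∀ φ : EuclideanSpace ℝ (Fin n) → ℝ, ContDiff ℝ ∞ φ → HasCompactSupport φ →
    ∀ i : Fin n, ∫ x, v x * fderiv ℝ φ x (EuclideanSpace.single i 1) = -∫ x, G x i * φ x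

/-- Membership in the homogeneous Sobolev space `Ẇ^{1,p}(ℝ^n)`: `v` is weakly differentiable with
weak gradient in `L^p`. -/
def MemHomogeneousSobolev {n : ℕ} (p : ℝ) (v : EuclideanSpace ℝ (Fin n) → ℝ) : Prop :=
  ∃ G : EuclideanSpace ℝ (Fin n) → EuclideanSpace ℝ (Fin n),
    HasWeakGradient v G ∧ MemLp G (ENNReal.ofReal p) volume

end

/-!
For `x` on the boundary, let `B(x, ε)` be a ball of radius `ε / 2` above `x` whose points are at
distance between `ε` and `2 ε` from `x`. If `|h| ≤ ε / 4`, then `B(x, ε)` and `B(x + h, ε)` share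
a ball of radius `ε / 4`. Averaging
`|v (x + h) - v x| ≤ |v (x + h) - u y| + |v x - u y|` over that ball bounds `‖Δ_h v‖_p^p` by
`C ε^(-N)` times the energy `∫ ∫_{B(x, ε)} |v x - u y|^p dy dx`.

Fix `h` and take the scales `ε = 4 |h| / 2^m`. As `‖Δ_h v‖_p ≤ 2^m ‖Δ_{h / 2^m} v‖_p`, the energy
at each of these scales is at least `c ε^(N + p) |h|^(-p) ‖Δ_h v‖_p^p`. The balls of different
scales are disjoint, so the double integral dominates the sum over `m` of the energies weighted by
`(2 ε)^(-(N + s p))`. This is a geometric series of ratio `2^(-(1 - s) p)`, and its sum times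
`1 - s` stays bounded below as `s → 1`. Hence `‖Δ_h v‖_p^p ≤ C L(u, v) |h|^p` for every `h`.

The difference quotients of `v` are therefore bounded in `L^p`, a uniformly convex space, and a weak
cluster point of those in direction `e` is the weak derivative of `v` in that direction.
-/

open scoped fwdDiff

section MidpointGap

variable {E : Type*} [NormedAddCommGroup E] [NormedSpace ℝ E] {p : ℝ}

/-- The midpoint convexity gap of `‖·‖ ^ p` at `a` and `b`. Its lower bounds quantify the strict
convexity of `‖·‖ ^ p`, and in this form they integrate from `E` to `L^p(μ; E)`. -/
noncomputable def midpointGap (p : ℝ) (a b : E) : ℝ :=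
  (‖a‖ ^ p + ‖b‖ ^ p) / 2 - ‖(1 / 2 : ℝ) • (a + b)‖ ^ p

theorem midpointGap_self (p : ℝ) (a : E) : midpointGap p a a = 0 := by
  rw [midpointGap, ← two_smul ℝ a, smul_smul]
  norm_num

theorem midpointGap_smul {c : ℝ} (hc : 0 ≤ c) (a b : E) :
    midpointGap p (c • a) (c • b) = c ^ p * midpointGap p a b := by
  rw [midpointGap, ← smul_add, smul_comm]
  simp only [norm_smul_of_nonneg hc, Real.mul_rpow hc (norm_nonneg _), midpointGap]
  ring

theorem midpointGap_pos [StrictConvexSpace ℝ E] (hp : 1 < p) {a b : E} (hab : a ≠ b) :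
    0 < midpointGap p a b := by
  have hp0 : 0 < p := zero_lt_one.trans hp
  rw [midpointGap, sub_pos]
  by_cases h : ‖a‖ = ‖b‖
  · rw [← h, add_self_div_two]
    exact Real.rpow_lt_rpow (norm_nonneg _) ((norm_midpoint_lt_iff h).2 hab) hp0
  · have hmid : ‖(1 / 2 : ℝ) • (a + b)‖ ≤ 1 / 2 * ‖a‖ + 1 / 2 * ‖b‖ := by
      rw [norm_smul_of_nonneg (by norm_num), ← mul_add]
      gcongr
      exact norm_add_le a b
    calc ‖(1 / 2 : ℝ) • (a + b)‖ ^ p ≤ (1 / 2 * ‖a‖ + 1 / 2 * ‖b‖) ^ p := by gcongr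
      _ < 1 / 2 * ‖a‖ ^ p + 1 / 2 * ‖b‖ ^ p :=
        (strictConvexOn_rpow hp).2 (norm_nonneg a) (norm_nonneg b) h (by norm_num) (by norm_num)
          (by norm_num)
      _ = (‖a‖ ^ p + ‖b‖ ^ p) / 2 := by ring

theorem midpointGap_nonneg [StrictConvexSpace ℝ E] (hp : 1 < p) (a b : E) :
    0 ≤ midpointGap p a b := by
  rcases eq_or_ne a b with rfl | hab
  · exact (midpointGap_self p a).ge
  · exact (midpointGap_pos hp hab).le

theorem exists_nat_norm_sub_rpow_lt_add_midpointGap [StrictConvexSpace ℝ E] (hp : 1 < p) {η : ℝ}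
    (hη : 0 < η) {a b : E} (hab : (a, b) ≠ 0) :
    ∃ k : ℕ, ‖a - b‖ ^ p < η * (‖a‖ ^ p + ‖b‖ ^ p) + k * midpointGap p a b := by
  rcases eq_or_ne a b with rfl | hne
  · have ha : a ≠ 0 := by rintro rfl; exact hab rfl
    refine ⟨0, ?_⟩
    rw [sub_self, norm_zero, Real.zero_rpow (zero_lt_one.trans hp).ne', midpointGap_self, mul_zero,
      add_zero]
    positivity
  · obtain ⟨k, hk⟩ := exists_nat_gt (‖a - b‖ ^ p / midpointGap p a b)
    rw [div_lt_iff₀ (midpointGap_pos hp hne)] at hk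
    exact ⟨k, hk.trans_le (le_add_of_nonneg_left (by positivity))⟩

theorem exists_norm_sub_rpow_le_add_midpointGap [StrictConvexSpace ℝ E] [FiniteDimensional ℝ E]
    (hp : 1 < p) {η : ℝ} (hη : 0 < η) : ∃ C : ℝ, 0 ≤ C ∧ ∀ a b : E,
      ‖a - b‖ ^ p ≤ η * (‖a‖ ^ p + ‖b‖ ^ p) + C * midpointGap p a b := by
  have hp0 : 0 < p := zero_lt_one.trans hp
  let U (k : ℕ) : Set (E × E) :=
    {q | ‖q.1 - q.2‖ ^ p < η * (‖q.1‖ ^ p + ‖q.2‖ ^ p) + k * midpointGap p q.1 q.2}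
  have hU_open (k : ℕ) : IsOpen (U k) := by
    unfold U midpointGap
    refine isOpen_lt ?_ ?_ <;>
      fun_prop (disch := first | exact hp0.le | exact fun _ => Or.inr hp0)
  have hU_mono : Monotone U := by
    intro k l hkl q hq
    have := midpointGap_nonneg hp q.1 q.2
    exact (Set.mem_ofPred_eq ▸ hq).trans_le (by gcongr)
  have hU_cover : Metric.sphere (0 : E × E) 1 ⊆ ⋃ k, U k := fun q hq =>
    Set.mem_iUnion.2 <| exists_nat_norm_sub_rpow_lt_add_midpointGap hp hη <|
      ne_zero_of_mem_sphere one_ne_zero ⟨q, hq⟩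
  have : ProperSpace (E × E) := FiniteDimensional.proper ℝ _
  obtain ⟨k, hk⟩ := (isCompact_sphere (0 : E × E) 1).elim_directed_cover U hU_open hU_cover
    hU_mono.directed_le
  refine ⟨k, k.cast_nonneg, fun a b => ?_⟩
  rcases eq_or_ne (a, b) 0 with h0 | h0
  · obtain ⟨rfl, rfl⟩ := Prod.mk_eq_zero.1 h0
    simp [midpointGap_self, Real.zero_rpow hp0.ne']
  have hr : 0 < ‖(a, b)‖⁻¹ := inv_pos.2 (norm_pos_iff.2 h0)
  have hmem : ‖(a, b)‖⁻¹ • (a, b) ∈ U k := hk (by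
    rw [mem_sphere_zero_iff_norm, norm_smul_of_nonneg hr.le,
      inv_mul_cancel₀ (norm_ne_zero_iff.2 h0)])
  simp only [U, Set.mem_ofPred_eq, Prod.smul_mk, midpointGap_smul hr.le, ← smul_sub,
    norm_smul_of_nonneg hr.le, Real.mul_rpow hr.le (norm_nonneg _)] at hmem
  rw [← mul_add, mul_left_comm, mul_left_comm (k : ℝ), ← mul_add] at hmem
  exact (lt_of_mul_lt_mul_left hmem (by positivity)).le

end MidpointGap

section UniformConvexity

variable {α E : Type*} {m : MeasurableSpace α} [NormedAddCommGroup E] {p : ℝ≥0∞}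

theorem Lp_norm_rpow_eq_integral {μ : Measure α} (hp0 : p ≠ 0) (hp : p ≠ ⊤) (f : Lp E p μ) :
    ‖f‖ ^ p.toReal = ∫ x, ‖f x‖ ^ p.toReal ∂μ := by
  rw [Lp.norm_def, (Lp.memLp f).eLpNorm_eq_integral_rpow_norm hp0 hp,
    ENNReal.toReal_ofReal (by positivity),
    Real.rpow_inv_rpow (by positivity) (ENNReal.toReal_pos hp0 hp).ne']

variable [NormedSpace ℝ E] [StrictConvexSpace ℝ E] [FiniteDimensional ℝ E] [Fact (1 ≤ p)]

theorem exists_Lp_norm_sub_rpow_le_add_midpointGap (μ : Measure α) (hp1 : 1 < p) (hp : p ≠ ⊤)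
    {η : ℝ} (hη : 0 < η) :
    ∃ C : ℝ, 0 ≤ C ∧ ∀ f g : Lp E p μ, ‖f - g‖ ^ p.toReal ≤
      η * (‖f‖ ^ p.toReal + ‖g‖ ^ p.toReal) + C * midpointGap p.toReal f g := by
  have hp0 : p ≠ 0 := (zero_lt_one.trans hp1).ne'
  have hpr : 1 < p.toReal := by
    simpa using (ENNReal.toReal_lt_toReal ENNReal.one_ne_top hp).2 hp1
  obtain ⟨C, hC0, hC⟩ := exists_norm_sub_rpow_le_add_midpointGap (E := E) hpr hη
  refine ⟨C, hC0, fun f g => ?_⟩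
  have hint (f : Lp E p μ) : Integrable (fun x => ‖f x‖ ^ p.toReal) μ :=
    (Lp.memLp f).integrable_norm_rpow hp0 hp
  have hsum : Integrable (fun x => ‖f x‖ ^ p.toReal + ‖g x‖ ^ p.toReal) μ := (hint f).add (hint g)
  have hgap : Integrable (fun x => (‖f x‖ ^ p.toReal + ‖g x‖ ^ p.toReal) / 2 -
      ‖((1 / 2 : ℝ) • (f + g)) x‖ ^ p.toReal) μ := (hsum.div_const 2).sub (hint _)
  simp only [midpointGap, Lp_norm_rpow_eq_integral hp0 hp]
  rw [← integral_add (hint f) (hint g), ← integral_div, ← integral_sub (hsum.div_const 2) (hint _),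
    ← integral_const_mul, ← integral_const_mul,
    ← integral_add (hsum.const_mul η) (hgap.const_mul C)]
  refine integral_mono_ae (hint _) ((hsum.const_mul η).add (hgap.const_mul C)) ?_
  filter_upwards [Lp.coeFn_sub f g, Lp.coeFn_smul (1 / 2 : ℝ) (f + g), Lp.coeFn_add f g]
    with x hsub hsmul hadd
  simpa only [hsub, hsmul, Pi.sub_apply, Pi.smul_apply, Pi.add_apply, hadd, midpointGap]
    using hC (f x) (g x)

theorem le_one_sub_div_of_rpow_le_one_sub {q t κ : ℝ} (hq : 1 ≤ q) (ht : 0 ≤ t)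
    (h : t ^ q ≤ 1 - κ) : t ≤ 1 - κ / q := by
  have hbernoulli : 1 + q * (t - 1) ≤ t ^ q := by
    simpa using one_add_mul_self_le_rpow_one_add (s := t - 1) (by linarith) hq
  have hκ : κ / q ≤ 1 - t := by
    rw [div_le_iff₀ (by positivity)]; linarith
  linarith

theorem uniformConvexSpace_Lp (μ : Measure α) (hp1 : 1 < p) (hp : p ≠ ⊤) :
    UniformConvexSpace (Lp E p μ) := by
  have hpr : 1 < p.toReal := by
    simpa using (ENNReal.toReal_lt_toReal ENNReal.one_ne_top hp).2 hp1
  refine ⟨fun ε hε => ?_⟩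
  set P := p.toReal with hP
  obtain ⟨C, hC0, hC⟩ := exists_Lp_norm_sub_rpow_le_add_midpointGap (E := E) μ hp1 hp
    (show 0 < ε ^ P / 4 by positivity)
  set κ := ε ^ P / (2 * (C + 1))
  refine ⟨2 * κ / P, by positivity, fun f hf g hg hfg => ?_⟩
  set t := ‖(1 / 2 : ℝ) • (f + g)‖ with ht
  have hpow : ε ^ P ≤ ε ^ P / 4 * 2 + C * (1 - t ^ P) := by
    calc ε ^ P ≤ ‖f - g‖ ^ P := by gcongr
      _ ≤ _ := hC f g
      _ = ε ^ P / 4 * 2 + C * (1 - t ^ P) := by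
        rw [midpointGap, hf, hg, Real.one_rpow, ← ht, ← hP]; norm_num
  have hpos : 0 < 1 - t ^ P := by
    by_contra! h
    have hεP : 0 < ε ^ P := by positivity
    linarith [mul_nonpos_of_nonneg_of_nonpos hC0 h]
  have hgap : κ ≤ 1 - t ^ P := by
    rw [div_le_iff₀ (by positivity)]
    linarith
  have ht_le : t ≤ 1 - κ / P :=
    le_one_sub_div_of_rpow_le_one_sub hpr.le (norm_nonneg _) (by linarith)
  have hnorm : ‖f + g‖ = 2 * t := by
    rw [ht, norm_smul_of_nonneg (by norm_num)]; ring
  rw [hnorm, mul_div_assoc]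
  linarith

end UniformConvexity

section Smulian

variable {X : Type*} [NormedAddCommGroup X] [NormedSpace ℝ X] [UniformConvexSpace X]

theorem exists_forall_norm_sub_le_of_le_norm_add {r ε : ℝ} (hr : 0 ≤ r) (hε : 0 < ε) :
    ∃ δ > 0, ∀ x y : X, ‖x‖ ≤ r + δ → ‖y‖ ≤ r + δ → 2 * (r - δ) ≤ ‖x + y‖ → ‖x - y‖ ≤ ε := by
  rcases hr.eq_or_lt with rfl | hr
  · refine ⟨ε / 2, by positivity, fun x y hx hy _ => ?_⟩
    linarith [norm_sub_le x y]
  obtain ⟨τ, hτ, h⟩ := exists_forall_closed_ball_dist_add_le_two_mul_sub X (half_pos hε) r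
  refine ⟨min r (τ / 5), by positivity, fun x y hx hy hxy => ?_⟩
  set δ := min r (τ / 5)
  have hδr : δ ≤ r := min_le_left _ _
  have hδτ : δ ≤ τ / 5 := min_le_right _ _
  have hδ : 0 < δ := by positivity
  by_contra! hlt
  -- Radial contraction brings `x` and `y` back into the ball of radius `r`.
  set c := r / (r + δ) with hc
  have hc0 : 0 ≤ c := by positivity
  have hc_half : 1 / 2 ≤ c := by rw [hc, div_le_div_iff₀ (by norm_num) (by positivity)]; linarith
  have hball (z : X) (hz : ‖z‖ ≤ r + δ) : ‖c • z‖ ≤ r := by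
    calc ‖c • z‖ = c * ‖z‖ := norm_smul_of_nonneg hc0 z
      _ ≤ c * (r + δ) := by gcongr
      _ = r := div_mul_cancel₀ _ (by positivity)
  have hsep : ε / 2 ≤ ‖c • x - c • y‖ := by
    rw [← smul_sub, norm_smul_of_nonneg hc0]
    nlinarith
  have hsum := h (hball x hx) (hball y hy) hsep
  rw [← smul_add, norm_smul_of_nonneg hc0] at hsum
  have hlow : 2 * (r - 2 * δ) ≤ c * ‖x + y‖ := by
    calc 2 * (r - 2 * δ) ≤ c * (2 * (r - δ)) := by
          rw [hc, div_mul_eq_mul_div, le_div_iff₀ (by positivity)]; nlinarith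
      _ ≤ c * ‖x + y‖ := by gcongr
  linarith

theorem cauchySeq_of_antitone_of_convex_of_norm_tendsto {K : ℕ → Set X} (hanti : Antitone K)
    (hconv : ∀ m, Convex ℝ (K m)) {d : ℕ → ℝ} (hd : ∀ m, ∀ x ∈ K m, d m ≤ ‖x‖) {r : ℝ}
    (hd_lim : Tendsto d atTop (𝓝 r)) {f : ℕ → X} (hfK : ∀ m, f m ∈ K m)
    (hf_lim : Tendsto (fun m => ‖f m‖) atTop (𝓝 r)) : CauchySeq f := by
  have hr : 0 ≤ r := ge_of_tendsto' hf_lim fun m => norm_nonneg _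
  rw [Metric.cauchySeq_iff']
  intro ε hε
  obtain ⟨δ, hδ, h⟩ := exists_forall_norm_sub_le_of_le_norm_add (X := X) hr (half_pos hε)
  obtain ⟨m, hdm, hfm⟩ := ((hd_lim.eventually (lt_mem_nhds (sub_lt_self r hδ))).and
    (eventually_forall_ge_atTop.2
      (hf_lim.eventually (ge_mem_nhds (lt_add_of_pos_right r hδ))))).exists
  refine ⟨m, fun l hl => ?_⟩
  have hmid : (1 / 2 : ℝ) • (f l + f m) ∈ K m := by
    rw [smul_add]
    exact hconv m (hanti hl (hfK l)) (hfK m) (by norm_num) (by norm_num) (by norm_num)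
  have hmid_norm := hd m _ hmid
  rw [norm_smul_of_nonneg (by norm_num)] at hmid_norm
  rw [dist_eq_norm]
  exact (h _ _ (hfm l hl) (hfm m le_rfl) (by linarith)).trans_lt (half_lt_self hε)

variable [CompleteSpace X]

theorem nonempty_iInter_of_antitone_of_isClosed_of_convex {K : ℕ → Set X} (hanti : Antitone K)
    (hclosed : ∀ m, IsClosed (K m)) (hconv : ∀ m, Convex ℝ (K m)) (hne : ∀ m, (K m).Nonempty)
    (hbdd : Bornology.IsBounded (K 0)) : (⋂ m, K m).Nonempty := by
  obtain ⟨R, hR⟩ := hbdd.exists_norm_le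
  set d : ℕ → ℝ := fun m => Metric.infDist 0 (K m)
  have hd_le {m : ℕ} {f : X} (hf : f ∈ K m) : d m ≤ ‖f‖ := by
    simpa using Metric.infDist_le_dist_of_mem (x := (0 : X)) hf
  have hd_mono : Monotone d := fun m l hml =>
    Metric.infDist_le_infDist_of_subset (hanti hml) (hne l)
  have hd_bdd : BddAbove (Set.range d) := ⟨R, by
    rintro _ ⟨m, rfl⟩
    obtain ⟨f, hf⟩ := hne m
    exact (hd_le hf).trans (hR f (hanti m.zero_le hf))⟩
  set r := ⨆ m, d m
  have hd_lim : Tendsto d atTop (𝓝 r) := tendsto_atTop_ciSup hd_mono hd_bdd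
  choose f hfK hf using fun m : ℕ => (Metric.infDist_lt_iff (hne m)).1
    (lt_add_of_pos_right (d m) (Nat.one_div_pos_of_nat (α := ℝ) (n := m)))
  have hf_lim : Tendsto (fun m => ‖f m‖) atTop (𝓝 r) :=
    tendsto_of_tendsto_of_tendsto_of_le_of_le hd_lim
      (by simpa using hd_lim.add (tendsto_one_div_add_atTop_nhds_zero_nat (𝕜 := ℝ)))
      (fun m => hd_le (hfK m)) (fun m => by simpa using (hf m).le)
  have hcauchy : CauchySeq f :=
    cauchySeq_of_antitone_of_convex_of_norm_tendsto hanti hconv (fun _ _ => hd_le) hd_lim hfK hf_lim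
  obtain ⟨g, hg⟩ := cauchySeq_tendsto_of_complete hcauchy
  refine ⟨g, Set.mem_iInter.2 fun m => (hclosed m).mem_of_tendsto hg ?_⟩
  filter_upwards [eventually_ge_atTop m] with l hl using hanti hl (hfK l)

-- The values of `l` at a point common to the closed convex hulls of all tails of `F` can only be
-- the limit of `l (F k)`; this replaces weak sequential compactness.
theorem exists_norm_le_and_forall_apply_eq_of_tendsto {F : ℕ → X} {R : ℝ} (hF : ∀ k, ‖F k‖ ≤ R) :
    ∃ f : X, ‖f‖ ≤ R ∧ ∀ (l : X →L[ℝ] ℝ) (c : ℝ),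
      Tendsto (fun k => l (F k)) atTop (𝓝 c) → l f = c := by
  set K : ℕ → Set X := fun m => closedConvexHull ℝ (F '' Set.Ici m)
  have hK_sub {m : ℕ} {S : Set X} (hS : Convex ℝ S) (hS' : IsClosed S) (h : ∀ k ≥ m, F k ∈ S) :
      K m ⊆ S := closedConvexHull_min (Set.image_subset_iff.2 h) hS hS'
  have hKR : K 0 ⊆ Metric.closedBall 0 R :=
    hK_sub (convex_closedBall _ _) Metric.isClosed_closedBall fun k _ => by simpa using hF k
  obtain ⟨f, hf⟩ := nonempty_iInter_of_antitone_of_isClosed_of_convex (K := K)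
    (fun m l hml => (closedConvexHull ℝ).monotone (Set.image_mono (Set.Ici_subset_Ici.2 hml)))
    (fun m => isClosed_closedConvexHull) (fun m => convex_closedConvexHull)
    (fun m => ⟨F m, subset_closedConvexHull ⟨m, Set.self_mem_Ici, rfl⟩⟩)
    (Metric.isBounded_closedBall.subset hKR)
  rw [Set.mem_iInter] at hf
  refine ⟨f, by simpa using hKR (hf 0), fun l c hl => ?_⟩
  refine eq_of_forall_dist_le fun ε hε => ?_
  obtain ⟨m, hm⟩ := (Metric.tendsto_atTop.1 hl ε hε)
  have hmem : f ∈ l ⁻¹' Metric.closedBall c ε :=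
    hK_sub ((convex_closedBall c ε).linear_preimage l.toLinearMap)
      (Metric.isClosed_closedBall.preimage l.continuous) (fun k hk => (hm k hk).le) (hf m)
  exact hmem

end Smulian

section DifferenceQuotients

variable {E : Type*} [NormedAddCommGroup E]

theorem support_fwdDiff_subset (h : E) (φ : E → ℝ) :
    Function.support (Δ_[h] φ) ⊆ Metric.cthickening ‖h‖ (tsupport φ) := by
  intro x hx
  by_cases h0 : φ x = 0
  · have h1 : φ (x + h) ≠ 0 := by simpa [fwdDiff, h0] using hx
    exact Metric.mem_cthickening_of_dist_le _ _ _ _ (subset_tsupport φ h1) (by simp)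
  · exact Metric.self_subset_cthickening _ (subset_tsupport φ h0)

variable [MeasurableSpace E] [BorelSpace E]

theorem exists_clm_Lp_apply_eq_integral_mul (μ : Measure E) [IsFiniteMeasureOnCompacts μ]
    (p : ℝ≥0∞) [Fact (1 ≤ p)] {φ : E → ℝ} (hφ : Continuous φ) (hφc : HasCompactSupport φ) :
    ∃ l : Lp ℝ p μ →L[ℝ] ℝ, ∀ f, l f = ∫ x, f x * φ x ∂μ := by
  have hφq : MemLp φ p.conjExponent μ := hφ.memLp_of_hasCompactSupport hφc
  have : p.HolderConjugate p.conjExponent := ENNReal.HolderConjugate.conjExponent Fact.out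
  have : Fact (1 ≤ p.conjExponent) := ⟨ENNReal.HolderConjugate.one_le p.conjExponent p⟩
  refine ⟨((ContinuousLinearMap.mul ℝ ℝ).lpPairing μ p p.conjExponent).flip (hφq.toLp φ),
    fun f => ?_⟩
  rw [ContinuousLinearMap.flip_apply, ContinuousLinearMap.lpPairing_eq_integral]
  refine integral_congr_ae ?_
  filter_upwards [hφq.coeFn_toLp] with x hx
  rw [hx, ContinuousLinearMap.mul_apply']

theorem integral_fwdDiff_mul {μ : Measure E} [μ.IsAddRightInvariant] [IsFiniteMeasureOnCompacts μ]
    {v φ : E → ℝ} (hv : LocallyIntegrable v μ) (hφ : Continuous φ) (hφc : HasCompactSupport φ)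
    (h : E) :
    ∫ x, Δ_[h] v x * φ x ∂μ = ∫ x, v x * Δ_[-h] φ x ∂μ := by
  have hint : Integrable (fun x => v x * φ x) μ :=
    hv.integrable_smul_right_of_hasCompactSupport hφ hφc
  have hint_neg : Integrable (fun x => v x * φ (x + -h)) μ :=
    hv.integrable_smul_right_of_hasCompactSupport (hφ.comp (continuous_add_const (-h)))
      (hφc.comp_homeomorph (Homeomorph.addRight (-h)))
  have hint_shift : Integrable (fun x => v (x + h) * φ x) μ := by
    simpa using hint_neg.comp_add_right h
  have htrans : ∫ x, v (x + h) * φ x ∂μ = ∫ x, v x * φ (x + -h) ∂μ := by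
    simpa using integral_add_right_eq_self (μ := μ) (fun x => v x * φ (x + -h)) h
  simp only [fwdDiff, sub_mul, mul_sub]
  rw [integral_sub hint_shift hint, htrans, integral_sub hint_neg hint]

end DifferenceQuotients

section WeakDerivative

variable {E : Type*} [NormedAddCommGroup E] [NormedSpace ℝ E] [FiniteDimensional ℝ E]
  [MeasurableSpace E] [BorelSpace E] {μ : Measure E} [μ.IsAddHaarMeasure]

theorem tendsto_integral_mul_inv_mul_fwdDiff {v φ : E → ℝ} (hv : LocallyIntegrable v μ)
    (hφ : ContDiff ℝ 1 φ) (hφc : HasCompactSupport φ) (e : E) :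
    Tendsto (fun t : ℝ => ∫ x, v x * (t⁻¹ * Δ_[t • e] φ x) ∂μ) (𝓝[>] 0)
      (𝓝 (∫ x, v x * fderiv ℝ φ x e ∂μ)) := by
  have := FiniteDimensional.proper ℝ E
  obtain ⟨C, hC⟩ := ContDiff.lipschitzWith_of_hasCompactSupport hφc hφ one_ne_zero
  set K := Metric.cthickening ‖e‖ (tsupport φ)
  have hK : IsCompact K := IsCompact.cthickening hφc
  have hw : Integrable (K.indicator v) μ :=
    (integrable_indicator_iff hK.measurableSet).2 (hv.integrableOn_isCompact hK)
  have hmul (f : E → ℝ) (hf : Function.support f ⊆ K) (x : E) :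
      f x * K.indicator v x = v x * f x := by
    by_cases hx : x ∈ K
    · rw [Set.indicator_of_mem hx, mul_comm]
    · rw [Function.notMem_support.1 fun h => hx (hf h), zero_mul, mul_zero]
  have hlim := hC.integral_inv_smul_sub_mul_tendsto_integral_lineDeriv_mul hw e
  have hderiv (x : E) : lineDeriv ℝ φ x e * K.indicator v x = v x * fderiv ℝ φ x e := by
    rw [(hφ.differentiable one_ne_zero x).lineDeriv_eq_fderiv]
    refine hmul (fun x => fderiv ℝ φ x e) (fun y hy => Metric.self_subset_cthickening _ ?_) x
    exact tsupport_fderiv_subset ℝ (subset_tsupport _ fun h0 => hy (by simp [h0]))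
  simp only [hderiv] at hlim
  refine hlim.congr' ?_
  filter_upwards [Ioc_mem_nhdsGT (zero_lt_one (α := ℝ))] with t ht
  refine integral_congr_ae (ae_of_all _ fun x => hmul (fun x => t⁻¹ * Δ_[t • e] φ x) ?_ x)
  refine (Function.support_mul_subset_right _ _).trans ((support_fwdDiff_subset _ φ).trans
    (Metric.cthickening_mono ?_ _))
  rw [norm_smul_of_nonneg ht.1.le]
  exact mul_le_of_le_one_left (norm_nonneg e) ht.2

theorem tendsto_integral_inv_mul_fwdDiff_mul {v φ : E → ℝ} (hv : LocallyIntegrable v μ)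
    (hφ : ContDiff ℝ 1 φ) (hφc : HasCompactSupport φ) (e : E) :
    Tendsto (fun t : ℝ => ∫ x, (t⁻¹ * Δ_[t • e] v x) * φ x ∂μ) (𝓝[>] 0)
      (𝓝 (-∫ x, v x * fderiv ℝ φ x e ∂μ)) := by
  have hlim := tendsto_integral_mul_inv_mul_fwdDiff hv hφ hφc (-e)
  simp only [map_neg, mul_neg, integral_neg, smul_neg] at hlim
  refine hlim.congr fun t => ?_
  simp only [mul_left_comm _ t⁻¹, mul_assoc, integral_const_mul]
  rw [integral_fwdDiff_mul hv hφ.continuous hφc]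

theorem exists_weak_directional_derivative {p : ℝ≥0∞} (hp1 : 1 < p) (hp : p ≠ ⊤) {v : E → ℝ}
    (hv : LocallyIntegrable v μ) (e : E) {A : ℝ≥0∞} (hA : A ≠ ⊤)
    (h : ∀ t : ℝ, 0 < t → eLpNorm (Δ_[t • e] v) p μ ≤ ENNReal.ofReal t * A) :
    ∃ g : E → ℝ, MemLp g p μ ∧ eLpNorm g p μ ≤ A ∧
      ∀ φ : E → ℝ, ContDiff ℝ 1 φ → HasCompactSupport φ →
        ∫ x, v x * fderiv ℝ φ x e ∂μ = -∫ x, g x * φ x ∂μ := by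
  have : Fact (1 ≤ p) := ⟨hp1.le⟩
  set t : ℕ → ℝ := fun k => 1 / (k + 1)
  have ht (k : ℕ) : 0 < t k := Nat.one_div_pos_of_nat
  have ht_lim : Tendsto t atTop (𝓝[>] 0) :=
    tendsto_nhdsWithin_iff.2 ⟨tendsto_one_div_add_atTop_nhds_zero_nat, Eventually.of_forall ht⟩
  set D : ℕ → E → ℝ := fun k => (t k)⁻¹ • Δ_[t k • e] v
  have hD_norm (k : ℕ) : eLpNorm (D k) p μ ≤ A := by
    calc eLpNorm (D k) p μ = (ENNReal.ofReal (t k))⁻¹ * eLpNorm (Δ_[t k • e] v) p μ := by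
          rw [eLpNorm_const_smul, enorm_inv (ht k).ne', Real.enorm_of_nonneg (ht k).le]
      _ ≤ (ENNReal.ofReal (t k))⁻¹ * (ENNReal.ofReal (t k) * A) := by gcongr; exact h _ (ht k)
      _ = A := ENNReal.inv_mul_cancel_left' (by simp [ht k]) (by simp)
  have hD (k : ℕ) : MemLp (D k) p μ := by
    refine ⟨AEStronglyMeasurable.const_smul (.sub ?_ hv.aestronglyMeasurable) _,
      (hD_norm k).trans_lt hA.lt_top⟩
    exact hv.aestronglyMeasurable.comp_measurePreserving
      (measurePreserving_add_right μ (t k • e))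
  have := uniformConvexSpace_Lp (E := ℝ) μ hp1 hp
  obtain ⟨g, hgA, hg⟩ := exists_norm_le_and_forall_apply_eq_of_tendsto
    (F := fun k => (hD k).toLp (D k)) (R := A.toReal) fun k => by
      rw [Lp.norm_toLp]; exact ENNReal.toReal_mono hA (hD_norm k)
  refine ⟨g, Lp.memLp g, ?_, fun φ hφ hφc => ?_⟩
  · rwa [Lp.norm_def, ENNReal.toReal_le_toReal (Lp.eLpNorm_ne_top g) hA] at hgA
  · obtain ⟨l, hl⟩ := exists_clm_Lp_apply_eq_integral_mul μ p hφ.continuous hφc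
    rw [← hl, hg l _ (((tendsto_integral_inv_mul_fwdDiff_mul hv hφ hφc e).comp ht_lim).congr
      fun k => ?_), neg_neg]
    rw [hl]
    refine integral_congr_ae ?_
    filter_upwards [(hD k).coeFn_toLp] with x hx
    rw [hx]; rfl

end WeakDerivative

section Increments

theorem eLpNorm_fwdDiff_nsmul_le {E F : Type*} [AddCommGroup E] [MeasurableSpace E]
    [MeasurableAdd E] [NormedAddCommGroup F] {μ : Measure E} [μ.IsAddRightInvariant] {p : ℝ≥0∞}
    (hp : 1 ≤ p) {v : E → F} (hv : AEStronglyMeasurable v μ) (h : E) (m : ℕ) :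
    eLpNorm (Δ_[m • h] v) p μ ≤ m * eLpNorm (Δ_[h] v) p μ := by
  have hshift (k : E) : MeasurePreserving (· + k) μ μ := measurePreserving_add_right μ k
  have hmeas (k : E) : AEStronglyMeasurable (Δ_[k] v) μ :=
    (hv.comp_measurePreserving (hshift k)).sub hv
  induction m with
  | zero =>
    have hzero : Δ_[0 • h] v = 0 := by ext x; simp [fwdDiff]
    rw [hzero, eLpNorm_zero]
    exact zero_le
  | succ m ih =>
    have hsplit : Δ_[(m + 1) • h] v = (Δ_[h] v ∘ (· + m • h)) + Δ_[m • h] v := by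
      ext x
      simp [fwdDiff, succ_nsmul, add_assoc]
    calc eLpNorm (Δ_[(m + 1) • h] v) p μ
        ≤ eLpNorm (Δ_[h] v ∘ (· + m • h)) p μ + eLpNorm (Δ_[m • h] v) p μ := by
          rw [hsplit]
          exact eLpNorm_add_le ((hmeas h).comp_measurePreserving (hshift _)) (hmeas _) hp
      _ ≤ eLpNorm (Δ_[h] v) p μ + m * eLpNorm (Δ_[h] v) p μ := by
          rw [eLpNorm_comp_measurePreserving (hmeas h) (hshift _)]
          gcongr
      _ = (m + 1 : ℕ) * eLpNorm (Δ_[h] v) p μ := by push_cast; ring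

theorem ae_integrableOn_fwdDiff {E : Type*} [AddCommGroup E] [MeasurableSpace E] [MeasurableAdd₂ E]
    {μ : Measure E} [SFinite μ] {p : ℝ≥0∞} (hp : 1 ≤ p) {v : E → ℝ} (hv : Measurable v)
    {s t : Set E} (hs : μ s ≠ ⊤) (ht : μ t ≠ ⊤) {M : ℝ≥0∞} (hM : M ≠ ⊤)
    (h : ∀ y ∈ t, eLpNorm (Δ_[y] v) p μ ≤ M) :
    ∀ᵐ x ∂μ.restrict s, IntegrableOn (fun y => Δ_[y] v x) t μ := by
  have hmeas : Measurable fun q : E × E => Δ_[q.2] v q.1 := by unfold fwdDiff; fun_prop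
  rcases eq_or_ne (μ s) 0 with hs0 | hs0
  · simp [Measure.restrict_eq_zero.2 hs0]
  set c := μ s ^ (1 / (1 : ℝ≥0∞).toReal - 1 / p.toReal) with hc
  have hc_top : c ≠ ⊤ := ENNReal.rpow_ne_top_of_ne_zero hs0 hs
  have hinner : ∀ y ∈ t, ∫⁻ x in s, ‖Δ_[y] v x‖ₑ ∂μ ≤ M * c := fun y hy => by
    calc ∫⁻ x in s, ‖Δ_[y] v x‖ₑ ∂μ = eLpNorm (Δ_[y] v) 1 (μ.restrict s) :=
          eLpNorm_one_eq_lintegral_enorm.symm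
      _ ≤ eLpNorm (Δ_[y] v) p (μ.restrict s) * c := by
          rw [hc, ← Measure.restrict_apply_univ s]
          exact eLpNorm_le_eLpNorm_mul_rpow_measure_univ hp
            (hmeas.comp measurable_prodMk_right).aestronglyMeasurable
      _ ≤ M * c := by
          gcongr
          exact (eLpNorm_mono_measure _ Measure.restrict_le_self).trans (h y hy)
  have hfin : ∫⁻ x in s, ∫⁻ y in t, ‖Δ_[y] v x‖ₑ ∂μ ∂μ ≠ ⊤ := by
    rw [lintegral_lintegral_swap hmeas.enorm.aemeasurable]
    refine ne_top_of_le_ne_top (ENNReal.mul_ne_top (ENNReal.mul_ne_top hM hc_top) ht) ?_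
    rw [← setLIntegral_const]
    exact setLIntegral_mono measurable_const hinner
  filter_upwards [ae_lt_top hmeas.enorm.lintegral_prod_right' hfin] with x hx
  exact ⟨(hmeas.comp measurable_prodMk_left).aestronglyMeasurable, hx⟩

variable {E : Type*} [NormedAddCommGroup E] [ProperSpace E] [MeasurableSpace E] [BorelSpace E]
  {μ : Measure E} [μ.IsAddHaarMeasure]

theorem locallyIntegrable_of_eLpNorm_fwdDiff_le {p : ℝ≥0∞} (hp : 1 ≤ p) {v : E → ℝ}
    (hv : Measurable v) {r : ℝ} (hr : 0 < r) {M : ℝ≥0∞} (hM : M ≠ ⊤)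
    (h : ∀ y ∈ Metric.ball (0 : E) r, eLpNorm (Δ_[y] v) p μ ≤ M) : LocallyIntegrable v μ := by
  intro z
  have hball (x : E) : μ (Metric.ball x r) ≠ ⊤ := measure_ball_lt_top.ne
  have : NeBot (ae (μ.restrict (Metric.ball z r))) :=
    ae_restrict_neBot.2 (Metric.measure_ball_pos μ z hr).ne'
  obtain ⟨x, hdiff, hxz⟩ := ((ae_integrableOn_fwdDiff hp hv (hball z) (hball 0) hM h).and
    (ae_restrict_mem Metric.isOpen_ball.measurableSet)).exists
  refine ⟨Metric.ball x r, Metric.isOpen_ball.mem_nhds (by rwa [Metric.mem_ball_comm]), ?_⟩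
  have hshift : IntegrableOn (v ∘ (x + ·)) (Metric.ball 0 r) μ :=
    (hdiff.add (integrableOn_const (C := v x) (hball 0))).congr
      (Eventually.of_forall fun y => by simp [fwdDiff])
  have hpre : (x + ·) ⁻¹' Metric.ball x r = Metric.ball 0 r := by ext; simp
  rwa [← hpre, (measurePreserving_add_left μ x).integrableOn_comp_preimage
    (measurableEmbedding_addLeft x)] at hshift

end Increments

section WeakGradient

variable {n : ℕ} {v : EuclideanSpace ℝ (Fin n) → ℝ}
  {G : EuclideanSpace ℝ (Fin n) → EuclideanSpace ℝ (Fin n)}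

theorem HasWeakGradient.congr_left {v' : EuclideanSpace ℝ (Fin n) → ℝ} (h : HasWeakGradient v G)
    (hv : v =ᵐ[volume] v') : HasWeakGradient v' G where
  locallyIntegrable := h.locallyIntegrable.congr hv
  locallyIntegrable_gradient := h.locallyIntegrable_gradient
  integral_eq φ hφ hφc i := by
    rw [← h.integral_eq φ hφ hφc i]
    refine integral_congr_ae ?_
    filter_upwards [hv] with x hx
    rw [hx]

theorem HasWeakGradient.locallyIntegrable_apply (h : HasWeakGradient v G) (i : Fin n) :
    LocallyIntegrable (fun x => G x i) volume := fun x => by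
  obtain ⟨s, hs, hG⟩ := h.locallyIntegrable_gradient x
  exact ⟨s, hs, (EuclideanSpace.proj (𝕜 := ℝ) i).integrable_comp hG⟩

theorem HasWeakGradient.ae_eq {G' : EuclideanSpace ℝ (Fin n) → EuclideanSpace ℝ (Fin n)}
    (h : HasWeakGradient v G) (h' : HasWeakGradient v G') : G =ᵐ[volume] G' := by
  have hcoord (i : Fin n) : ∀ᵐ x, G x i = G' x i := by
    refine ae_eq_of_integral_contDiff_smul_eq (h.locallyIntegrable_apply i)
      (h'.locallyIntegrable_apply i) fun φ hφ hφc => ?_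
    have heq := (h.integral_eq φ hφ hφc i).symm.trans (h'.integral_eq φ hφ hφc i)
    simpa only [smul_eq_mul, mul_comm] using neg_inj.1 heq
  filter_upwards [ae_all_iff.2 hcoord] with x hx
  ext i
  exact hx i

theorem exists_hasWeakGradient_of_eLpNorm_fwdDiff_le {p : ℝ≥0∞} (hp1 : 1 < p) (hp : p ≠ ⊤)
    (hv : Measurable v) {A : ℝ≥0∞} (hA : A ≠ ⊤)
    (h : ∀ y, eLpNorm (Δ_[y] v) p volume ≤ ‖y‖ₑ * A) :
    ∃ G, HasWeakGradient v G ∧ MemLp G p volume ∧ eLpNorm G p volume ≤ n * A := by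
  have hv_loc : LocallyIntegrable v volume := by
    refine locallyIntegrable_of_eLpNorm_fwdDiff_le hp1.le hv one_pos hA fun y hy => (h y).trans ?_
    refine mul_le_of_le_one_left' ?_
    rw [← ofReal_norm, ENNReal.ofReal_le_one]
    exact (mem_ball_zero_iff.1 hy).le
  choose g hg hgA hgφ using fun i : Fin n =>
    exists_weak_directional_derivative hp1 hp hv_loc (EuclideanSpace.single i 1) hA fun t ht =>
      (h _).trans_eq (by simp [← ofReal_norm, norm_smul, abs_of_pos ht])
  set G : EuclideanSpace ℝ (Fin n) → EuclideanSpace ℝ (Fin n) :=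
    ∑ i, fun x => g i x • EuclideanSpace.single i (1 : ℝ) with hG_def
  have hG_apply (x : EuclideanSpace ℝ (Fin n)) (i : Fin n) : G x i = g i x := by
    simp [hG_def, Pi.single_apply]
  have hsummand (i : Fin n) : MemLp (fun x => g i x • EuclideanSpace.single i (1 : ℝ)) p volume :=
    (ContinuousLinearMap.toSpanSingleton ℝ (EuclideanSpace.single i (1 : ℝ))).comp_memLp' (hg i)
  have hG : MemLp G p volume := memLp_finsetSum' _ fun i _ => hsummand i
  refine ⟨G, ⟨hv_loc, hG.locallyIntegrable hp1.le, fun φ hφ hφc i => ?_⟩, hG, ?_⟩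
  · simpa only [hG_apply] using hgφ i φ (hφ.of_le (by simp)) hφc
  · calc eLpNorm G p volume
        ≤ ∑ i, eLpNorm (fun x => g i x • EuclideanSpace.single i (1 : ℝ)) p volume :=
          eLpNorm_sum_le (fun i _ => (hsummand i).aestronglyMeasurable) hp1.le
      _ ≤ ∑ _i : Fin n, A := by
          gcongr with i
          refine (eLpNorm_mono fun x => ?_).trans (hgA i)
          simp [norm_smul]
      _ = n * A := by simp

end WeakGradient

section BoundaryPoint

variable {n : ℕ}

theorem boundaryPoint_last (x : EuclideanSpace ℝ (Fin n)) :
    boundaryPoint x (Fin.last n) = 0 := by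
  simp [boundaryPoint]

theorem isometry_boundaryPoint :
    Isometry (boundaryPoint : EuclideanSpace ℝ (Fin n) → EuclideanSpace ℝ (Fin (n + 1))) :=
  Isometry.of_dist_eq fun x y => by
    simp [EuclideanSpace.dist_eq, Fin.sum_univ_castSucc, boundaryPoint]

end BoundaryPoint

section WhitneyBall

variable {n : ℕ}

/-- The centre of `whitneyBall x ε`, at height `3 ε / 2` above the boundary point `x`. -/
noncomputable def whitneyCenter (x : EuclideanSpace ℝ (Fin n)) (ε : ℝ) :
    EuclideanSpace ℝ (Fin (n + 1)) :=
  boundaryPoint x + EuclideanSpace.single (Fin.last n) (3 / 2 * ε)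

/-- The Whitney ball of scale `ε` above the boundary point `x`. The radius is chosen so that its
points lie in the half-space, at a distance between `ε` and `2 ε` from `x`. -/
def whitneyBall (x : EuclideanSpace ℝ (Fin n)) (ε : ℝ) : Set (EuclideanSpace ℝ (Fin (n + 1))) :=
  Metric.ball (whitneyCenter x ε) (ε / 2)

theorem dist_whitneyCenter (x y : EuclideanSpace ℝ (Fin n)) (ε : ℝ) :
    dist (whitneyCenter x ε) (whitneyCenter y ε) = dist x y := by
  rw [whitneyCenter, whitneyCenter, dist_add_right, isometry_boundaryPoint.dist_eq]

theorem ball_whitneyCenter_subset_whitneyBall {x y : EuclideanSpace ℝ (Fin n)} {ε : ℝ}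
    (h : dist x y ≤ ε / 4) : Metric.ball (whitneyCenter x ε) (ε / 4) ⊆ whitneyBall y ε :=
  Metric.ball_subset_ball' (by rw [dist_whitneyCenter]; linarith)

theorem whitneyBall_subset_openHalfSpace (x : EuclideanSpace ℝ (Fin n)) {ε : ℝ} (hε : 0 < ε) :
    whitneyBall x ε ⊆ openHalfSpace n := fun y hy => by
  have hcoord : ‖y (Fin.last n) - 3 / 2 * ε‖ < ε / 2 := by
    refine lt_of_le_of_lt ?_ (mem_ball_iff_norm.1 hy)
    simpa [whitneyCenter, boundaryPoint_last] using
      PiLp.norm_apply_le (y - whitneyCenter x ε) (Fin.last n)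
  have hlow := (abs_lt.1 hcoord).1
  change 0 < y (Fin.last n)
  linarith

theorem dist_mem_Ioo_of_mem_whitneyBall {x : EuclideanSpace ℝ (Fin n)} {ε : ℝ} (hε : 0 < ε)
    {y : EuclideanSpace ℝ (Fin (n + 1))} (hy : y ∈ whitneyBall x ε) :
    dist (boundaryPoint x) y ∈ Set.Ioo ε (2 * ε) := by
  have hcenter : dist (boundaryPoint x) (whitneyCenter x ε) = 3 / 2 * ε := by
    simp [whitneyCenter, abs_of_pos hε]
  have hlow := dist_triangle (boundaryPoint x) y (whitneyCenter x ε)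
  have hupp := dist_triangle_right (boundaryPoint x) y (whitneyCenter x ε)
  have hy' : dist y (whitneyCenter x ε) < ε / 2 := hy
  constructor <;> linarith

theorem pairwise_disjoint_whitneyBall (x : EuclideanSpace ℝ (Fin n)) {r : ℝ} (hr : 0 < r) :
    Pairwise (Function.onFun Disjoint fun m : ℕ => whitneyBall x (r / 2 ^ m)) := by
  have hr' (m : ℕ) : 0 < r / 2 ^ m := by positivity
  refine (pairwise_disjoint_on _).2 fun m l hml => Set.disjoint_left.2 fun y hm hl => ?_
  have hscale : 2 * (r / 2 ^ l) ≤ r / 2 ^ m := by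
    calc 2 * (r / 2 ^ l) ≤ 2 * (r / 2 ^ (m + 1)) := by gcongr; exacts [one_le_two, hml]
      _ = r / 2 ^ m := by field_simp; ring
  linarith [(dist_mem_Ioo_of_mem_whitneyBall (hr' m) hm).1,
    (dist_mem_Ioo_of_mem_whitneyBall (hr' l) hl).2]

end WhitneyBall

section WhitneyEnergy

variable {n : ℕ} {p ε : ℝ} {u : EuclideanSpace ℝ (Fin (n + 1)) → ℝ}
  {v : EuclideanSpace ℝ (Fin n) → ℝ}

/-- The `p`-energy of the jump between `v x` and the values of `u` in the Whitney ball of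
scale `ε` above `x`. -/
noncomputable def whitneyEnergy (p : ℝ) (u : EuclideanSpace ℝ (Fin (n + 1)) → ℝ)
    (v : EuclideanSpace ℝ (Fin n) → ℝ) (ε : ℝ) (x : EuclideanSpace ℝ (Fin n)) : ℝ≥0∞ :=
  ∫⁻ y in whitneyBall x ε, ‖v x - u y‖ₑ ^ p

theorem measurable_whitneyEnergy (hu : Measurable u) (hv : Measurable v) (p ε : ℝ) :
    Measurable (whitneyEnergy p u v ε) := by
  let S : Set (EuclideanSpace ℝ (Fin n) × EuclideanSpace ℝ (Fin (n + 1))) :=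
    {q | q.2 ∈ whitneyBall q.1 ε}
  have hcenter : Continuous fun x : EuclideanSpace ℝ (Fin n) => whitneyCenter x ε :=
    isometry_boundaryPoint.continuous.add continuous_const
  have hS : IsOpen S :=
    isOpen_lt (continuous_snd.dist (hcenter.comp continuous_fst)) continuous_const
  have hmeas : Measurable fun q : EuclideanSpace ℝ (Fin n) × EuclideanSpace ℝ (Fin (n + 1)) =>
      ‖v q.1 - u q.2‖ₑ ^ p := by fun_prop
  have hind := (hmeas.indicator hS.measurableSet).lintegral_prod_right' (ν := volume)
  convert hind using 2 with x
  exact (lintegral_indicator Metric.isOpen_ball.measurableSet _).symm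

theorem volume_ball_mul_enorm_fwdDiff_rpow_le (hp : 1 ≤ p) (hu : Measurable u)
    {x h : EuclideanSpace ℝ (Fin n)} (hh : ‖h‖ ≤ ε / 4) :
    volume (Metric.ball (0 : EuclideanSpace ℝ (Fin (n + 1))) (ε / 4)) * ‖Δ_[h] v x‖ₑ ^ p ≤
      2 ^ (p - 1) * (whitneyEnergy p u v ε (x + h) + whitneyEnergy p u v ε x) := by
  have hε : 0 ≤ ε / 4 := (norm_nonneg h).trans hh
  let B := Metric.ball (whitneyCenter x ε) (ε / 4)
  have hpt (y : EuclideanSpace ℝ (Fin (n + 1))) :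
      ‖Δ_[h] v x‖ₑ ^ p ≤ 2 ^ (p - 1) * (‖v (x + h) - u y‖ₑ ^ p + ‖v x - u y‖ₑ ^ p) := by
    refine le_trans ?_ (ENNReal.rpow_add_le_mul_rpow_add_rpow _ _ hp)
    gcongr
    rw [fwdDiff, ← sub_sub_sub_cancel_right _ _ (u y)]
    exact enorm_sub_le
  calc volume (Metric.ball (0 : EuclideanSpace ℝ (Fin (n + 1))) (ε / 4)) * ‖Δ_[h] v x‖ₑ ^ p
      = ∫⁻ _ in B, ‖Δ_[h] v x‖ₑ ^ p := by
        rw [setLIntegral_const, mul_comm, Measure.addHaar_ball_center volume (whitneyCenter x ε)]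
    _ ≤ ∫⁻ y in B, 2 ^ (p - 1) * (‖v (x + h) - u y‖ₑ ^ p + ‖v x - u y‖ₑ ^ p) :=
        lintegral_mono hpt
    _ = 2 ^ (p - 1) * ((∫⁻ y in B, ‖v (x + h) - u y‖ₑ ^ p) + ∫⁻ y in B, ‖v x - u y‖ₑ ^ p) := by
        rw [lintegral_const_mul' _ _ (by finiteness), lintegral_add_left (by fun_prop)]
    _ ≤ 2 ^ (p - 1) * (whitneyEnergy p u v ε (x + h) + whitneyEnergy p u v ε x) := by
        gcongr
        · exact lintegral_mono_set (ball_whitneyCenter_subset_whitneyBall (by simpa using hh))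
        · exact lintegral_mono_set (ball_whitneyCenter_subset_whitneyBall (by simpa using hε))

theorem volume_ball_mul_lintegral_fwdDiff_le (hp : 1 ≤ p) (hu : Measurable u) (hv : Measurable v)
    {h : EuclideanSpace ℝ (Fin n)} (hh : ‖h‖ ≤ ε / 4) :
    volume (Metric.ball (0 : EuclideanSpace ℝ (Fin (n + 1))) (ε / 4)) *
      ∫⁻ x, ‖Δ_[h] v x‖ₑ ^ p ≤ 2 ^ p * ∫⁻ x, whitneyEnergy p u v ε x := by
  calc volume (Metric.ball (0 : EuclideanSpace ℝ (Fin (n + 1))) (ε / 4)) *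
        ∫⁻ x, ‖Δ_[h] v x‖ₑ ^ p
      ≤ ∫⁻ x, 2 ^ (p - 1) * (whitneyEnergy p u v ε (x + h) + whitneyEnergy p u v ε x) := by
        rw [← lintegral_const_mul' _ _ measure_ball_lt_top.ne]
        exact lintegral_mono fun x => volume_ball_mul_enorm_fwdDiff_rpow_le hp hu hh
    _ = 2 ^ (p - 1) * (2 * ∫⁻ x, whitneyEnergy p u v ε x) := by
        rw [lintegral_const_mul' _ _ (by finiteness),
          lintegral_add_right _ (measurable_whitneyEnergy hu hv p ε),
          lintegral_add_right_eq_self (whitneyEnergy p u v ε), two_mul]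
    _ = 2 ^ p * ∫⁻ x, whitneyEnergy p u v ε x := by
        rw [← mul_assoc, ENNReal.rpow_sub _ _ (by norm_num) (by norm_num), ENNReal.rpow_one,
          ENNReal.div_mul_cancel (by norm_num) (by norm_num)]

theorem ofReal_rpow_mul_whitneyEnergy_le {a : ℝ} (ha : 0 ≤ a) (hp : 0 ≤ p) (hε : 0 < ε)
    (x : EuclideanSpace ℝ (Fin n)) :
    ENNReal.ofReal ((2 * ε) ^ (-a)) * whitneyEnergy p u v ε x ≤
      ∫⁻ y in whitneyBall x ε,
        ENNReal.ofReal (|v x - u y| ^ p / dist (boundaryPoint x) y ^ a) := by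
  rw [whitneyEnergy, ← lintegral_const_mul' _ _ ENNReal.ofReal_ne_top]
  refine setLIntegral_mono' Metric.isOpen_ball.measurableSet fun y hy => ?_
  have hdist := dist_mem_Ioo_of_mem_whitneyBall hε hy
  have hpos : 0 < dist (boundaryPoint x) y := hε.trans hdist.1
  rw [← ofReal_norm, Real.norm_eq_abs, ENNReal.ofReal_rpow_of_nonneg (abs_nonneg _) hp,
    ← ENNReal.ofReal_mul (by positivity), Real.rpow_neg (by positivity), ← div_eq_inv_mul]
  gcongr
  exact hdist.2.le

theorem tsum_whitneyEnergy_le_traceConjunctionIntegral {s : ℝ} (hs : 0 ≤ s) (hp : 0 ≤ p)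
    (hu : Measurable u) (hv : Measurable v) {r : ℝ} (hr : 0 < r) :
    ∑' m : ℕ, ENNReal.ofReal ((2 * (r / 2 ^ m)) ^ (-(((n + 1 : ℕ) : ℝ) + s * p))) *
      ∫⁻ x, whitneyEnergy p u v (r / 2 ^ m) x ≤ traceConjunctionIntegral n s p u v := by
  simp only [← lintegral_const_mul' _ _ ENNReal.ofReal_ne_top]
  rw [← lintegral_tsum fun m => ((measurable_whitneyEnergy hu hv p _).const_mul _).aemeasurable]
  refine lintegral_mono fun x => ?_
  calc _ ≤ ∑' m : ℕ, ∫⁻ y in whitneyBall x (r / 2 ^ m), ENNReal.ofReal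
        (|v x - u y| ^ p / dist (boundaryPoint x) y ^ (((n + 1 : ℕ) : ℝ) + s * p)) :=
        ENNReal.tsum_le_tsum fun m =>
          ofReal_rpow_mul_whitneyEnergy_le (by positivity) hp (by positivity) x
    _ = ∫⁻ y in ⋃ m : ℕ, whitneyBall x (r / 2 ^ m), ENNReal.ofReal
        (|v x - u y| ^ p / dist (boundaryPoint x) y ^ (((n + 1 : ℕ) : ℝ) + s * p)) :=
        (lintegral_iUnion (fun m => Metric.isOpen_ball.measurableSet)
          (pairwise_disjoint_whitneyBall x hr) _).symm
    _ ≤ _ := lintegral_mono_set <| Set.iUnion_subset fun m =>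
        whitneyBall_subset_openHalfSpace x (by positivity)

end WhitneyEnergy

section DyadicSum

theorem one_le_ofReal_mul_tsum_two_rpow_neg_pow {x : ℝ} (hx : 0 < x) :
    1 ≤ ENNReal.ofReal x * ∑' m : ℕ, ENNReal.ofReal (2 ^ (-x)) ^ m := by
  have hlt : (2 : ℝ) ^ (-x) < 1 := Real.rpow_lt_one_of_one_lt_of_neg one_lt_two (neg_neg_of_pos hx)
  have hle : 1 - (2 : ℝ) ^ (-x) ≤ x := by
    have hexp := Real.add_one_le_exp (Real.log 2 * -x)
    rw [← Real.rpow_def_of_pos two_pos] at hexp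
    nlinarith [Real.log_two_lt_d9]
  rw [ENNReal.tsum_geometric, ← ENNReal.ofReal_one, ← ENNReal.ofReal_sub _ (by positivity),
    ← ENNReal.ofReal_inv_of_pos (sub_pos.2 hlt), ← ENNReal.ofReal_mul hx.le]
  exact ENNReal.ofReal_le_ofReal ((one_le_div (sub_pos.2 hlt)).2 hle)

theorem ofReal_rpow_mul_le_ofReal_mul_tsum_dyadic {a b r : ℝ} (hab : a < b) (hr : 0 < r)
    {B : ℝ≥0∞} {E : ℕ → ℝ≥0∞} (h : ∀ m, ENNReal.ofReal ((r / 2 ^ m) ^ b) * B ≤ E m) :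
    ENNReal.ofReal (r ^ (b - a)) * B ≤
      ENNReal.ofReal (b - a) * ∑' m : ℕ, ENNReal.ofReal ((r / 2 ^ m) ^ (-a)) * E m := by
  have hpow (m : ℕ) : ENNReal.ofReal (2 ^ (-(b - a))) ^ m * ENNReal.ofReal (r ^ (b - a)) =
      ENNReal.ofReal ((r / 2 ^ m) ^ (-a)) * ENNReal.ofReal ((r / 2 ^ m) ^ b) := by
    rw [← ENNReal.ofReal_mul (by positivity), ← Real.rpow_add (by positivity),
      ← ENNReal.ofReal_pow (by positivity), ← ENNReal.ofReal_mul (by positivity),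
      ← Real.rpow_mul_natCast two_pos.le, Real.div_rpow hr.le (by positivity),
      ← Real.rpow_natCast_mul two_pos.le, div_eq_inv_mul, ← Real.rpow_neg two_pos.le]
    ring_nf
  calc ENNReal.ofReal (r ^ (b - a)) * B
      ≤ (ENNReal.ofReal (b - a) * ∑' m : ℕ, ENNReal.ofReal (2 ^ (-(b - a))) ^ m) *
          (ENNReal.ofReal (r ^ (b - a)) * B) :=
        le_mul_of_one_le_left' (one_le_ofReal_mul_tsum_two_rpow_neg_pow (sub_pos.2 hab))
    _ = ENNReal.ofReal (b - a) * ∑' m : ℕ, ENNReal.ofReal ((r / 2 ^ m) ^ (-a)) *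
          (ENNReal.ofReal ((r / 2 ^ m) ^ b) * B) := by
        simp only [mul_assoc, ← ENNReal.tsum_mul_right]
        simp only [← mul_assoc, hpow]
    _ ≤ ENNReal.ofReal (b - a) * ∑' m : ℕ, ENNReal.ofReal ((r / 2 ^ m) ^ (-a)) * E m := by
        gcongr with m
        exact h m

end DyadicSum

section LowerLimit

variable {n : ℕ} {p : ℝ} {u : EuclideanSpace ℝ (Fin (n + 1)) → ℝ}
  {v : EuclideanSpace ℝ (Fin n) → ℝ}

theorem liminfTraceConjunction_congr {u' : EuclideanSpace ℝ (Fin (n + 1)) → ℝ}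
    {v' : EuclideanSpace ℝ (Fin n) → ℝ} (hu : u =ᵐ[volume.restrict (openHalfSpace n)] u')
    (hv : v =ᵐ[volume] v') : liminfTraceConjunction n p u v = liminfTraceConjunction n p u' v' := by
  have hintegral (s : ℝ) :
      traceConjunctionIntegral n s p u v = traceConjunctionIntegral n s p u' v' := by
    refine lintegral_congr_ae (hv.mono fun x hx => lintegral_congr_ae (hu.mono fun y hy => ?_))
    simp only [hx, hy]
  simp only [liminfTraceConjunction, hintegral]

theorem le_mul_liminfTraceConjunction (hp : 0 < p) (hu : Measurable u) (hv : Measurable v) {r : ℝ}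
    (hr : 0 < r) {B : ℝ≥0∞}
    (h : ∀ m : ℕ, ENNReal.ofReal ((2 * (r / 2 ^ m)) ^ (((n + 1 : ℕ) : ℝ) + p)) * B ≤
      ∫⁻ x, whitneyEnergy p u v (r / 2 ^ m) x) :
    B ≤ ENNReal.ofReal p * liminfTraceConjunction n p u v := by
  have hs : ∀ᶠ s : ℝ in 𝓝[<] 1, ENNReal.ofReal ((2 * r) ^ ((1 - s) * p)) * B ≤
      ENNReal.ofReal p * (ENNReal.ofReal (1 - s) * traceConjunctionIntegral n s p u v) := by
    filter_upwards [Ioo_mem_nhdsLT (zero_lt_one' ℝ)] with s hs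
    have hexp : ((n + 1 : ℕ) + p) - ((n + 1 : ℕ) + s * p) = (1 - s) * p := by ring
    have hdyadic := ofReal_rpow_mul_le_ofReal_mul_tsum_dyadic
      (a := ((n + 1 : ℕ) : ℝ) + s * p) (b := ((n + 1 : ℕ) : ℝ) + p) (by nlinarith [hs.2])
      (by positivity : 0 < 2 * r) (by simpa only [mul_div_assoc] using h)
    rw [hexp, ENNReal.ofReal_mul (sub_nonneg.2 hs.2.le), mul_comm (ENNReal.ofReal (1 - s)),
      mul_assoc (ENNReal.ofReal p)] at hdyadic
    refine hdyadic.trans ?_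
    simp only [mul_div_assoc]
    gcongr
    exact tsum_whitneyEnergy_le_traceConjunctionIntegral hs.1.le hp.le hu hv hr
  have hlim : Tendsto (fun s : ℝ => ENNReal.ofReal ((2 * r) ^ ((1 - s) * p)) * B) (𝓝[<] 1)
      (𝓝 B) := by
    have hcont : Continuous fun s : ℝ => ENNReal.ofReal ((2 * r) ^ ((1 - s) * p)) := by
      refine ENNReal.continuous_ofReal.comp (Continuous.rpow continuous_const (by fun_prop) ?_)
      exact fun _ => Or.inl (by positivity)
    have hone := hcont.tendsto 1
    simp only [sub_self, zero_mul, Real.rpow_zero, ENNReal.ofReal_one] at hone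
    simpa using ENNReal.Tendsto.mul_const (hone.mono_left nhdsWithin_le_nhds)
      (Or.inl one_ne_zero)
  rw [liminfTraceConjunction, ← ENNReal.liminf_const_mul_of_ne_top ENNReal.ofReal_ne_top,
    ← hlim.liminf_eq]
  exact liminf_le_liminf hs

end LowerLimit

section IncrementBound

variable {n : ℕ} {p : ℝ} {u : EuclideanSpace ℝ (Fin (n + 1)) → ℝ}
  {v : EuclideanSpace ℝ (Fin n) → ℝ}

theorem eLpNorm_ofReal_rpow {α F : Type*} {m : MeasurableSpace α} {μ : Measure α}
    [NormedAddCommGroup F] (hp : 0 < p) (f : α → F) :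
    eLpNorm f (ENNReal.ofReal p) μ ^ p = ∫⁻ x, ‖f x‖ₑ ^ p ∂μ := by
  have hpow := eLpNorm_nnreal_pow_eq_lintegral (μ := μ) (f := f) (Real.toNNReal_pos.2 hp).ne'
  rwa [Real.coe_toNNReal p hp.le] at hpow

theorem lintegral_fwdDiff_nsmul_rpow_le {E F : Type*} [AddCommGroup E] [MeasurableSpace E]
    [MeasurableAdd E] [NormedAddCommGroup F] {μ : Measure E} [μ.IsAddRightInvariant] (hp : 1 ≤ p)
    {v : E → F} (hv : AEStronglyMeasurable v μ) (h : E) (m : ℕ) :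
    ∫⁻ x, ‖Δ_[m • h] v x‖ₑ ^ p ∂μ ≤ m ^ p * ∫⁻ x, ‖Δ_[h] v x‖ₑ ^ p ∂μ := by
  have hp0 : 0 < p := one_pos.trans_le hp
  rw [← eLpNorm_ofReal_rpow hp0, ← eLpNorm_ofReal_rpow hp0, ← ENNReal.mul_rpow_of_nonneg _ _ hp0.le]
  gcongr
  exact eLpNorm_fwdDiff_nsmul_le (by simpa using hp) hv h m

theorem ofReal_rpow_mul_volume_ball {ε : ℝ} (hp : 0 ≤ p) (hε : 0 ≤ ε) :
    ENNReal.ofReal ((2 * ε) ^ (((n + 1 : ℕ) : ℝ) + p)) *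
        volume (Metric.ball (0 : EuclideanSpace ℝ (Fin (n + 1))) 1) =
      8 ^ (n + 1) * ENNReal.ofReal (2 * ε) ^ p *
        volume (Metric.ball (0 : EuclideanSpace ℝ (Fin (n + 1))) (ε / 4)) := by
  have hscale : (2 * ε) ^ (n + 1) = 8 ^ (n + 1) * (ε / 4) ^ (n + 1) := by
    rw [← mul_pow]
    ring
  rw [Measure.addHaar_ball volume _ (by positivity : 0 ≤ ε / 4), finrank_euclideanSpace_fin,
    Real.rpow_add_of_nonneg (by positivity) (by positivity) hp, Real.rpow_natCast, hscale,
    ENNReal.ofReal_mul (by positivity), ENNReal.ofReal_mul (by positivity),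
    ENNReal.ofReal_rpow_of_nonneg (by positivity) hp, ENNReal.ofReal_pow (by norm_num),
    ENNReal.ofReal_ofNat]
  ring

theorem ofReal_rpow_mul_lintegral_fwdDiff_le (hp : 1 ≤ p) (hu : Measurable u) (hv : Measurable v)
    (h : EuclideanSpace ℝ (Fin n)) (m : ℕ) :
    ENNReal.ofReal ((2 * (4 * ‖h‖ / 2 ^ m)) ^ (((n + 1 : ℕ) : ℝ) + p)) *
        (volume (Metric.ball (0 : EuclideanSpace ℝ (Fin (n + 1))) 1) * ∫⁻ x, ‖Δ_[h] v x‖ₑ ^ p) ≤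
      8 ^ (n + 1) * 16 ^ p * ‖h‖ₑ ^ p * ∫⁻ x, whitneyEnergy p u v (4 * ‖h‖ / 2 ^ m) x := by
  have hp0 : 0 < p := one_pos.trans_le hp
  set w := volume (Metric.ball (0 : EuclideanSpace ℝ (Fin (n + 1))) 1)
  let k : EuclideanSpace ℝ (Fin n) := ((2 : ℝ) ^ m)⁻¹ • h
  let ε : ℝ := 4 * ‖h‖ / 2 ^ m
  have hk : ‖k‖ = ε / 4 := by
    rw [norm_smul, norm_inv, Real.norm_of_nonneg (by positivity)]
    ring
  have hmk : (2 ^ m : ℕ) • k = h := by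
    rw [← Nat.cast_smul_eq_nsmul ℝ, Nat.cast_pow, Nat.cast_ofNat, smul_inv_smul₀ (by positivity)]
  have hscale : ENNReal.ofReal (2 * ε) ^ p * (2 ^ m : ℕ) ^ p = 8 ^ p * ‖h‖ₑ ^ p := by
    have hε : 2 * ε * (2 ^ m : ℕ) = 8 * ‖h‖ := by
      change 2 * (4 * ‖h‖ / 2 ^ m) * (2 ^ m : ℕ) = 8 * ‖h‖
      push_cast
      field_simp
      ring
    rw [← ENNReal.mul_rpow_of_nonneg _ _ hp0.le, ← ENNReal.ofReal_natCast (2 ^ m),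
      ← ENNReal.ofReal_mul (by positivity), hε, ENNReal.ofReal_mul (by norm_num),
      ENNReal.ofReal_ofNat, ofReal_norm, ENNReal.mul_rpow_of_nonneg _ _ hp0.le]
  calc ENNReal.ofReal ((2 * ε) ^ (((n + 1 : ℕ) : ℝ) + p)) * (w * ∫⁻ x, ‖Δ_[h] v x‖ₑ ^ p)
      ≤ ENNReal.ofReal ((2 * ε) ^ (((n + 1 : ℕ) : ℝ) + p)) *
          (w * ((2 ^ m : ℕ) ^ p * ∫⁻ x, ‖Δ_[k] v x‖ₑ ^ p)) := by
        gcongr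
        simpa only [hmk] using
          lintegral_fwdDiff_nsmul_rpow_le (μ := volume) hp hv.aestronglyMeasurable k (2 ^ m)
    _ = 8 ^ (n + 1) * (ENNReal.ofReal (2 * ε) ^ p * (2 ^ m : ℕ) ^ p) *
          (volume (Metric.ball (0 : EuclideanSpace ℝ (Fin (n + 1))) (ε / 4)) *
            ∫⁻ x, ‖Δ_[k] v x‖ₑ ^ p) := by
        rw [← mul_assoc, ofReal_rpow_mul_volume_ball hp0.le (by positivity)]
        ring
    _ ≤ 8 ^ (n + 1) * (8 ^ p * ‖h‖ₑ ^ p) * (2 ^ p * ∫⁻ x, whitneyEnergy p u v ε x) := by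
        rw [hscale]
        gcongr _ * ?_
        exact volume_ball_mul_lintegral_fwdDiff_le hp hu hv hk.le
    _ = 8 ^ (n + 1) * 16 ^ p * ‖h‖ₑ ^ p * ∫⁻ x, whitneyEnergy p u v ε x := by
        rw [show (16 : ℝ≥0∞) = 8 * 2 by norm_num, ENNReal.mul_rpow_of_nonneg _ _ hp0.le]
        ring

theorem exists_eLpNorm_fwdDiff_rpow_le (n : ℕ) (hp : 1 ≤ p) :
    ∃ C : ℝ≥0, ∀ (u : EuclideanSpace ℝ (Fin (n + 1)) → ℝ) (v : EuclideanSpace ℝ (Fin n) → ℝ),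
      Measurable u → Measurable v → ∀ h : EuclideanSpace ℝ (Fin n),
        eLpNorm (Δ_[h] v) (ENNReal.ofReal p) volume ^ p ≤
          C * liminfTraceConjunction n p u v * ‖h‖ₑ ^ p := by
  have hp0 : 0 < p := one_pos.trans_le hp
  set w := volume (Metric.ball (0 : EuclideanSpace ℝ (Fin (n + 1))) 1)
  have hw0 : w ≠ 0 := (Metric.measure_ball_pos volume _ one_pos).ne'
  have hw : w ≠ ⊤ := measure_ball_lt_top.ne
  have hC : 8 ^ (n + 1) * 16 ^ p * ENNReal.ofReal p * w⁻¹ ≠ ⊤ := by finiteness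
  refine ⟨(8 ^ (n + 1) * 16 ^ p * ENNReal.ofReal p * w⁻¹).toNNReal, fun u v hu hv h => ?_⟩
  rw [ENNReal.coe_toNNReal hC, eLpNorm_ofReal_rpow hp0]
  rcases eq_or_ne h 0 with rfl | hh
  · simp [fwdDiff, hp0]
  set K : ℝ≥0∞ := 8 ^ (n + 1) * 16 ^ p * ‖h‖ₑ ^ p with hK
  have hK0 : K ≠ 0 := by simp [hK, hh]
  have hKtop : K ≠ ⊤ := by finiteness
  have hdiv : w * (∫⁻ x, ‖Δ_[h] v x‖ₑ ^ p) / K ≤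
      ENNReal.ofReal p * liminfTraceConjunction n p u v := by
    refine le_mul_liminfTraceConjunction hp0 hu hv (r := 4 * ‖h‖) (by positivity) fun m => ?_
    rw [← mul_div_assoc]
    exact ENNReal.div_le_of_le_mul' (ofReal_rpow_mul_lintegral_fwdDiff_le hp hu hv h m)
  calc ∫⁻ x, ‖Δ_[h] v x‖ₑ ^ p = w⁻¹ * (K * (w * (∫⁻ x, ‖Δ_[h] v x‖ₑ ^ p) / K)) := by
        rw [ENNReal.mul_div_cancel hK0 hKtop, ← mul_assoc, ENNReal.inv_mul_cancel hw0 hw, one_mul]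
    _ ≤ w⁻¹ * (K * (ENNReal.ofReal p * liminfTraceConjunction n p u v)) := by gcongr
    _ = _ := by rw [hK]; ring

end IncrementBound

theorem theorem8p3 (n : ℕ) (hn : 1 ≤ n) (p : ℝ) (hp : 1 < p) :
    ∃ C : ℝ≥0, ∀ (u : EuclideanSpace ℝ (Fin (n + 1)) → ℝ) (v : EuclideanSpace ℝ (Fin n) → ℝ),
      AEMeasurable u (volume.restrict (openHalfSpace n)) → AEMeasurable v volume →
      liminfTraceConjunction n p u v < ⊤ →
        MemHomogeneousSobolev p v ∧
        ∀ G : EuclideanSpace ℝ (Fin n) → EuclideanSpace ℝ (Fin n), HasWeakGradient v G →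
          (∫⁻ x, ‖G x‖ₑ ^ p) ≤ C * liminfTraceConjunction n p u v := by
  have hp0 : 0 < p := one_pos.trans hp
  obtain ⟨C, hC⟩ := exists_eLpNorm_fwdDiff_rpow_le n hp.le
  refine ⟨(n : ℝ≥0) ^ p * C, fun u v hu hv hL => ?_⟩
  rw [liminfTraceConjunction_congr hu.ae_eq_mk hv.ae_eq_mk] at hL ⊢
  set L := liminfTraceConjunction n p (hu.mk u) (hv.mk v)
  have hincrement (y : EuclideanSpace ℝ (Fin n)) :
      eLpNorm (Δ_[y] (hv.mk v)) (ENNReal.ofReal p) volume ≤ ‖y‖ₑ * (C * L) ^ p⁻¹ := by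
    rw [← ENNReal.rpow_le_rpow_iff hp0, ENNReal.mul_rpow_of_nonneg _ _ hp0.le,
      ENNReal.rpow_inv_rpow hp0.ne', mul_comm]
    exact hC _ _ hu.measurable_mk hv.measurable_mk y
  obtain ⟨G₀, hG₀, hG₀p, hG₀L⟩ := exists_hasWeakGradient_of_eLpNorm_fwdDiff_le
    (ENNReal.one_lt_ofReal.2 hp) ENNReal.ofReal_ne_top hv.measurable_mk (by finiteness) hincrement
  have hG₀v : HasWeakGradient v G₀ := hG₀.congr_left hv.ae_eq_mk.symm
  refine ⟨⟨G₀, hG₀v, hG₀p⟩, fun G hG => ?_⟩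
  calc ∫⁻ x, ‖G x‖ₑ ^ p = eLpNorm G₀ (ENNReal.ofReal p) volume ^ p := by
        rw [← eLpNorm_ofReal_rpow hp0, eLpNorm_congr_ae (hG.ae_eq hG₀v)]
    _ ≤ (n * (C * L) ^ p⁻¹) ^ p := by gcongr
    _ = ((n : ℝ≥0) ^ p * C : ℝ≥0) * L := by
        rw [ENNReal.mul_rpow_of_nonneg _ _ hp0.le, ENNReal.rpow_inv_rpow hp0.ne',
          ENNReal.coe_mul, ENNReal.coe_rpow_of_nonneg _ hp0.le, ENNReal.coe_natCast, mul_assoc]
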